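/- \textbf{Conventions.} Manifolds are smooth, oriented and without boundary; diffeomorphisms and codimension-zero embeddings preserve orientation; homology has integer coefficients; $T^2=S^1\times S^1$. Let $X$ be a 4-manifold and $T\subset X$ a smoothly embedded 2-torus with a framing $\phi:\nu(T)\to T^2\times D^2$, where $\nu(T)$ is a closed tubular neighbourhood of $T$ and $\phi(T)=T^2\times\{0\}$; in $X\setminus\nu(T)$ the boundary $\partial\nu(T)$ is included. The meridian $\mu_T\subset\partial\nu(T)$ is the curve $\phi^{-1}(\{pt\}\times\partial D^2)$. The push-off of a curve $c\subset T^2$ (equivalently, of the corresponding curve on $T$) is $\phi^{-1}(c\times\{d\})$ with $d\in\partial D^2$. A primitive curve is a simple loop homotopic to $a^rb^s$ with $r,s$ relatively prime, where $a,b$ are the two circle factors of $T^2$. Let $p,q$ be relatively prime integers and let $\gamma\subset\partial\nu(T)$ be the push-off of a primitive curve on $T$. A 4-manifold $X'$ is the result $X_{T,\gamma}(p/q)$ of $(p/q)$-torus surgery on $T$ along $\gamma$ if $$X'=(X\setminus\nu(T))\cup_\varphi(T^2\times D^2)$$ for some diffeomorphism $\varphi:T^2\times\partial D^2\to\partial(X\setminus\nu(T))$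 with $$\varphi_*[\{pt\}\times\partial D^2]=q[\gamma]+p[\mu_T]\in H_1(\partial(X\setminus\nu(T))).$$ The core torus $\widehat T$ is $T^2\times\{0\}\subset T^2\times D^2\subset X'$. Its natural framing is the identification of a tubular neighbourhood $\nu(\widehat T)$ with the glued-in copy of $T^2\times D^2$, so that $X'\setminus\nu(\widehat T)=X\setminus\nu(T)$. Write $X_{T,\gamma}(p)=X_{T,\gamma}(p/1)$ and call this a $p$-torus surgery. \textbf{Statement.} Let $p\in\mathbb Z$, and let $X'=X_{T,\gamma}(p)$ be given by a gluing map $\varphi$, with core torus $\widehat T_p$. (1) Let $\alpha$ be any primitive curve on $\widehat T_p$ whose push-off, with respect to the natural framing, is homologous to the meridian $\mu_T$ under the identification $\partial(X'\setminus\nu(\widehat T_p))=\partial(X\setminus\nu(T))$. Then $X$ is the result of $0$-torus surgery on $\widehat T_p\subset X'$ along $\alpha$, with respect to the natural framing. The identification of the exteriors is the given one, and the core torus of this surgery is $T$ with natural framing $\phi$. (2) The gluing map can be chosen so that such a curve exists. That is, the same manifold $X'$, with the same embedded exterior $X\setminus\nu(T)$, the same neighbourhood $\nu(\widehat T_p)$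 and the same parametrized core torus $\widehat T_p$, is also the result of $p$-torus surgery on $T$ along $\gamma$ by a gluing map $\varphi'$ for which there is a primitive curve $\alpha$ on $\widehat T_p$ whose push-off, in the natural framing given by $\varphi'$, is freely homotopic to $\mu_T$ in $\partial(X'\setminus\nu(\widehat T_p))=\partial(X\setminus\nu(T))$. Consequently $X$ is the result of $0$-torus surgery on $\widehat T_p\subset X'$ along $\alpha$ in this framing, again with the given identification of the exteriors and with core torus $T$ framed by $\phi$. -/

import Mathlib

open scoped Manifold ContDiff

universe u

/-! ### Singular homology classes of loops -/

/-- First singular homology with integer coefficients. -/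
noncomputable abbrev singularH1 (Y : Type u) [TopologicalSpace Y] : AddCommGrpCat.{u} :=
  ((AlgebraicTopology.singularHomologyFunctor AddCommGrpCat.{u} 1).obj
    (AddCommGrpCat.of (ULift.{u} ℤ))).obj (TopCat.of Y)

/-- The homomorphism `H₁(S¹; ℤ) ⟶ H₁(Y; ℤ)` induced by a loop `c`. As `H₁(S¹; ℤ)` is infinite
cyclic, generated by the fundamental class `[S¹]`, it is the same datum as the class
`[c] = c_*[S¹]`: integral linear relations between the homomorphisms of several loops are exactly
the integral linear relations between their classes. -/
noncomputable def loopClass {Y : Type u} [TopologicalSpace Y] (c : C(Circle, Y)) :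
    singularH1 (ULift.{u} Circle) ⟶ singularH1 Y :=
  ((AlgebraicTopology.singularHomologyFunctor AddCommGrpCat.{u} 1).obj
    (AddCommGrpCat.of (ULift.{u} ℤ))).map
      (TopCat.ofHom (c.comp ⟨ULift.down, continuous_uliftDown⟩))

/-- `[l] = m [l₁] + n [l₂]` in `H₁(S; ℤ)`, for three loops `l`, `l₁`, `l₂` in the subspace `S`. -/
def HomologyRelationIn {X : Type*} [TopologicalSpace X] (S : Set X)
    (l : Circle → X) (m : ℤ) (l₁ : Circle → X) (n : ℤ) (l₂ : Circle → X) : Prop :=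
  ∃ c c₁ c₂ : C(Circle, S),
    (∀ t, (c t : X) = l t) ∧ (∀ t, (c₁ t : X) = l₁ t) ∧ (∀ t, (c₂ t : X) = l₂ t) ∧
      loopClass c = m • loopClass c₁ + n • loopClass c₂

/-- Two loops in the subspace `S` are homologous in `S`. -/
def HomologousIn {X : Type*} [TopologicalSpace X] (S : Set X) (l l' : Circle → X) : Prop :=
  ∃ c c' : C(Circle, S),
    (∀ t, (c t : X) = l t) ∧ (∀ t, (c' t : X) = l' t) ∧ loopClass c = loopClass c'

/-- Two loops in the subspace `S` are freely homotopic in `S`. -/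
def FreelyHomotopicIn {X : Type*} [TopologicalSpace X] (S : Set X) (l l' : Circle → X) : Prop :=
  ∃ c c' : C(Circle, S),
    (∀ t, (c t : X) = l t) ∧ (∀ t, (c' t : X) = l' t) ∧ c.Homotopic c'

/-! ### Smooth and oriented 4-manifolds -/

/-- `f` restricts to a diffeomorphism of the subset `s` onto its image `f '' s` (smooth maps
between subsets, in particular between codimension zero submanifolds with boundary). -/
def IsDiffeoOnImage {E H M E' H' M' : Type*}
    [NormedAddCommGroup E] [NormedSpace ℝ E] [TopologicalSpace H] (I : ModelWithCorners ℝ E H)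
    [TopologicalSpace M] [ChartedSpace H M]
    [NormedAddCommGroup E'] [NormedSpace ℝ E'] [TopologicalSpace H']
    (I' : ModelWithCorners ℝ E' H') [TopologicalSpace M'] [ChartedSpace H' M']
    (f : M → M') (s : Set M) : Prop :=
  ContMDiffOn I I' ∞ f s ∧ ∃ g : M' → M, ContMDiffOn I' I ∞ g (f '' s) ∧ Set.LeftInvOn g f s

/-- An orientation of a smooth 4-manifold: an atlas of smooth charts whose transition maps have
positive Jacobian determinant. -/
structure SmoothOrientation (X : Type*) [TopologicalSpace X]
    [ChartedSpace (EuclideanSpace ℝ (Fin 4)) X] where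
  charts : Set (OpenPartialHomeomorph X (EuclideanSpace ℝ (Fin 4)))
  smooth : charts ⊆ IsManifold.maximalAtlas (𝓡 4) ∞ X
  cover : ∀ x : X, ∃ e ∈ charts, x ∈ e.source
  compatible : ∀ e ∈ charts, ∀ e' ∈ charts, ∀ x ∈ e.source ∩ e'.source,
    0 < (fderiv ℝ (e' ∘ e.symm) (e x)).det

/-- The map `f` preserves orientations at the points of `s` (a set in whose interior points `f`
is a local diffeomorphism; only used for open sets `s`). -/
def PreservesOrientationOn {X Y : Type*}
    [TopologicalSpace X] [ChartedSpace (EuclideanSpace ℝ (Fin 4)) X]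
    [TopologicalSpace Y] [ChartedSpace (EuclideanSpace ℝ (Fin 4)) Y]
    (oX : SmoothOrientation X) (oY : SmoothOrientation Y) (f : X → Y) (s : Set X) : Prop :=
  ∀ x ∈ s, ∀ e ∈ oX.charts, ∀ e' ∈ oY.charts, x ∈ e.source → f x ∈ e'.source →
    0 < (fderiv ℝ (e' ∘ f ∘ e.symm) (e x)).det

/-! ### Framed tori -/

/-- `T² × ℂ`, with `T² = S¹ × S¹`; it contains `T² × D²`, `D²` being the closed unit disc. -/
abbrev TorusPlane : Type := Circle × Circle × ℂ

/-- The product smooth structure on `T² × ℂ`. -/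
noncomputable abbrev torusPlaneModel := (𝓡 1).prod ((𝓡 1).prod 𝓘(ℝ, ℂ))

/-- `T² × D²`. -/
def discBundle : Set TorusPlane := {x | ‖x.2.2‖ ≤ 1}

/-- `T² × int D²`. -/
def openDiscBundle : Set TorusPlane := {x | ‖x.2.2‖ < 1}

/-- `T² × ∂D²`. -/
def circleBundle : Set TorusPlane := {x | ‖x.2.2‖ = 1}

/-- `T² × {0}`. -/
def zeroSection : Set TorusPlane := {x | x.2.2 = 0}

/-- The local diffeomorphism `ℝ⁴ → T² × ℂ`, `(a, b, u, v) ↦ (e^{ia}, e^{ib}, u + iv)`, which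
defines the product orientation of `T² × ℂ`. -/
noncomputable def torusPlaneCover (v : EuclideanSpace ℝ (Fin 4)) : TorusPlane :=
  (Circle.exp (v 0), Circle.exp (v 1), (v 2 : ℂ) + (v 3 : ℂ) * Complex.I)

/-- A framing of the 2-torus `T ⊆ X`, written as the inverse `T² × D² → ν(T) ⊆ X` of a
diffeomorphism `ν(T) → T² × D²`: an orientation preserving smooth embedding of `T² × D²` that
carries `T² × {0}` onto `T`. Its values off `T² × D²` are irrelevant. In particular `T` is a smoothly
embedded 2-torus with trivial normal bundle. -/
structure Framing {X : Type*} [TopologicalSpace X] [ChartedSpace (EuclideanSpace ℝ (Fin 4)) X]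
    (oX : SmoothOrientation X) (T : Set X) where
  toFun : TorusPlane → X
  diffeo : IsDiffeoOnImage torusPlaneModel (𝓡 4) toFun discBundle
  oriented : ∀ v, torusPlaneCover v ∈ openDiscBundle → ∀ e ∈ oX.charts,
    toFun (torusPlaneCover v) ∈ e.source →
      0 < (fderiv ℝ (e ∘ toFun ∘ torusPlaneCover) v).det
  image_zeroSection : toFun '' zeroSection = T

namespace Framing

variable {X : Type*} [TopologicalSpace X] [ChartedSpace (EuclideanSpace ℝ (Fin 4)) X]
  {oX : SmoothOrientation X} {T : Set X} (Φ : Framing oX T)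

/-- The closed tubular neighbourhood `ν(T)`. -/
def nbhd : Set X := Φ.toFun '' discBundle

/-- The 3-torus `∂ν(T) = ∂(X \ ν(T))`. -/
def boundary : Set X := Φ.toFun '' circleBundle

/-- The exterior `X \ ν(T)`, including its boundary `∂ν(T)`. -/
def exterior : Set X := (Φ.toFun '' openDiscBundle)ᶜ

/-- The meridian `μ_T`, the image of `{pt} × ∂D²`. -/
noncomputable def meridian (t : Circle) : X := Φ.toFun (1, 1, (t : ℂ))

/-- The push-off to `∂ν(T)` of a curve on `T`, the latter being parametrized by `T²`. -/
noncomputable def pushOff (γ : C(Circle, Circle × Circle)) (t : Circle) : X :=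
  Φ.toFun ((γ t).1, (γ t).2, 1)

end Framing

/-! ### Torus surgery -/

/-- The loop `a ^ r * b ^ s` on `T² = S¹ × S¹`, where `a` and `b` are the two circle factors. -/
noncomputable def linearLoop (r s : ℤ) : C(Circle, Circle × Circle) where
  toFun t := (t ^ r, t ^ s)
  continuous_toFun := by fun_prop

/-- A primitive curve on `T²`: a simple loop that is homotopic to `a ^ r * b ^ s` for
relatively prime integers `r` and `s`. -/
def IsPrimitiveCurve (γ : C(Circle, Circle × Circle)) : Prop :=
  Function.Injective γ ∧ ∃ r s : ℤ, IsCoprime r s ∧ γ.Homotopic (linearLoop r s)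

/-- A presentation of the oriented 4-manifold `Y` as the result
`(X \ ν(T)) ∪_φ (T² × D²)` of the `(p / q)`-torus surgery on the torus `T ⊆ X`, framed by `Φ`,
along the curve `γ`: the two pieces are embedded in `Y`, preserving orientations, they cover `Y`,
and they meet exactly along their boundaries, which are identified through the gluing map `φ`. -/
structure TorusSurgery {X Y : Type*}
    [TopologicalSpace X] [ChartedSpace (EuclideanSpace ℝ (Fin 4)) X]
    [TopologicalSpace Y] [ChartedSpace (EuclideanSpace ℝ (Fin 4)) Y]
    {oX : SmoothOrientation X} {T : Set X} (Φ : Framing oX T)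
    (γ : C(Circle, Circle × Circle)) (p q : ℤ) (oY : SmoothOrientation Y) where
  coprime : IsCoprime p q
  primitive : IsPrimitiveCurve γ
  /-- The inclusion `X \ ν(T) → Y`; its values off the exterior are irrelevant. -/
  incl : X → Y
  incl_diffeo : IsDiffeoOnImage (𝓡 4) (𝓡 4) incl Φ.exterior
  incl_oriented : PreservesOrientationOn oX oY incl Φ.nbhdᶜ
  /-- The core torus of the surgery. -/
  core : Set Y
  /-- The inclusion of the glued-in copy of `T² × D²`, which is the natural framing of the core. -/
  tube : Framing oY core
  /-- The gluing diffeomorphism `φ : T² × ∂D² → ∂(X \ ν(T))`. -/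
  gluing : TorusPlane → X
  gluing_diffeo : IsDiffeoOnImage torusPlaneModel (𝓡 4) gluing circleBundle
  gluing_image : gluing '' circleBundle = Φ.boundary
  incl_gluing : ∀ x ∈ circleBundle, incl (gluing x) = tube.toFun x
  cover : incl '' Φ.exterior ∪ tube.nbhd = Set.univ
  inter : incl '' Φ.exterior ∩ tube.nbhd = tube.boundary
  /-- `φ_*[{pt} × ∂D²] = q [γ] + p [μ_T]` in `H₁(∂(X \ ν(T)))`. -/
  gluing_homology : HomologyRelationIn Φ.boundary (fun t : Circle => gluing (1, 1, (t : ℂ)))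
    q (Φ.pushOff γ) p Φ.meridian

/-! ### Circle-valued maps, real lifts and degrees -/

/-! A surgery only exchanges one copy of `T² × D²` for another, so it is undone by gluing `ν(T)`
back to the same exterior. The inverse gluing map is the inclusion of `∂ν(T)`, which sends `{pt} ×
∂D²` to the meridian `μ_T`. If `μ_T` is homologous to the push-off of `α`, its class is `1 · [α] + 0
· [μ]`, with `μ` the meridian of the core. This is a `0`-surgery along `α`
(`TorusSurgery.exists_inverse`).

For the second part, read the gluing map in the two framings as a self-homeomorphism of the 3-torus
acting on degrees of loops by an invertible integral matrix `M`. The surgery condition says `M e₃ =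
(r, s, p)` with `(r, s)` the coprime degrees of `γ`. In the glued-in coordinates the meridian has
degrees `v = M⁻¹ e₃`. Since `(r, s, p)` and `e₃` extend to a basis of `ℤ³`, so do their images `e₃`
and `v` under `M⁻¹`; hence `v 0` and `v 1` are coprime (`isCoprime_of_mulVec_single`). The only
obstruction to `μ_T` being a push-off is `v 2`. The twist `(x, y, z) ↦ (x, y, x ^ i * y ^ j * z)`
with `i * v 0 + j * v 1 = v 2` absorbs it. It extends over `T² × D²`, fixes the core and the fibre
over `(1, 1)`, and so changes neither the manifold nor the surgery coefficient.

Degrees are read off from singular homology by winding homomorphisms `H₁ → ℝ`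
(`Circle.HasDegree.eq_of_loopClass`). On a torus, equal degrees give an explicit homotopy, so `H₁`
of the 3-torus is never computed. -/

/-- Two continuous real functions on a connected space with the same exponential differ by a
constant. -/
theorem Circle.sub_eq_sub_of_exp_eq {A : Type*} [TopologicalSpace A] [PreconnectedSpace A]
    {f g : A → ℝ} (hf : Continuous f) (hg : Continuous g)
    (h : ∀ a, Circle.exp (f a) = Circle.exp (g a)) (a b : A) : f a - g a = f b - g b := by
  have := Circle.isCoveringMap_exp.eq_of_comp_eq (g₁ := fun x => f x - g x + g b)
    (g₂ := fun _ => f b) (by fun_prop) (by fun_prop) (by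
      funext x
      simp only [Function.comp_apply, Circle.exp_add, Circle.exp_sub, h]
      simp) b (by simp)
  have := congrFun this a
  linarith

/-- Homotopic circle-valued maps differ by the exponential of a real function. -/
theorem Circle.exists_eq_mul_exp_of_homotopic {A : Type*} [TopologicalSpace A]
    {f₀ f₁ : C(A, Circle)} (h : f₀.Homotopic f₁) :
    ∃ g : C(A, ℝ), ∀ a, f₁ a = f₀ a * Circle.exp (g a) := by
  obtain ⟨H⟩ := h
  -- After division by `f₀` the homotopy starts at the constant `1`, which the zero function lifts.
  let K : C(unitInterval × A, Circle) :=
    ⟨fun x => H x / f₀ x.2, by fun_prop⟩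
  have hK : ∀ a, K (0, a) = Circle.exp ((ContinuousMap.const A (0 : ℝ)) a) := by
    intro a; simp [K]
  let G := Circle.isCoveringMap_exp.liftHomotopy K (.const A (0 : ℝ)) hK
  refine ⟨⟨fun a => G (1, a), by fun_prop⟩, fun a => ?_⟩
  have h1 := congrFun (Circle.isCoveringMap_exp.liftHomotopy_lifts K (.const A (0 : ℝ)) hK) (1, a)
  simp only [Function.comp_apply] at h1
  change f₁ a = f₀ a * Circle.exp (Circle.isCoveringMap_exp.liftHomotopy K (.const A (0 : ℝ)) hK (1, a))
  rw [h1]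
  simp [K]

/-- A circle-valued map on a contractible space has a real lift. -/
theorem Circle.exists_exp_lift {A : Type*} [TopologicalSpace A] [ContractibleSpace A]
    (f : C(A, Circle)) : ∃ g : C(A, ℝ), ∀ a, f a = Circle.exp (g a) := by
  obtain ⟨a₀, ha₀⟩ := id_nullhomotopic A
  have h : (ContinuousMap.const A (f a₀)).Homotopic f :=
    ((ContinuousMap.Homotopic.refl f).comp ha₀).symm
  obtain ⟨g, hg⟩ := Circle.exists_eq_mul_exp_of_homotopic h
  obtain ⟨e, he⟩ := Circle.exp_surjective (f a₀)
  refine ⟨⟨fun a => e + g a, by fun_prop⟩, fun a => ?_⟩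
  rw [hg, ContinuousMap.const_apply, ← he, ← Circle.exp_add]
  rfl

/-- A circle-valued map on a torus is a character times the exponential of a real function. -/
theorem Circle.exists_eq_prod_zpow_mul_exp {ι : Type*} [Fintype ι] (h : C(ι → Circle, Circle)) :
    ∃ (n : ι → ℤ) (g : C(ι → Circle, ℝ)),
      ∀ x, h x = (∏ i, x i ^ n i) * Circle.exp (g x) := by
  classical
  -- On the universal cover `h` has a real lift `H`. Its failure `D` to be periodic is additive in
  -- the lattice vector and takes values in `2πℤ`, so it is given by integers `n i`. Subtracting the
  -- linear function `∑ n i * v i` leaves a periodic function, which descends to the torus.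
  let E : C(ι → ℝ, ι → Circle) := ⟨fun v i => Circle.exp (v i), by fun_prop⟩
  obtain ⟨H, hH⟩ := Circle.exists_exp_lift (h.comp E)
  have hE : ∀ v (k : ι → ℤ), E (fun i => v i + k i * (2 * Real.pi)) = E v := by
    intro v k; funext i
    exact Circle.exp_eq_exp.2 ⟨k i, rfl⟩
  have hper : ∀ (k : ι → ℤ) v, H (fun i => v i + k i * (2 * Real.pi)) - H v =
      H (fun i => k i * (2 * Real.pi)) - H 0 := by
    intro k v
    have := Circle.sub_eq_sub_of_exp_eq (f := fun v => H (fun i => v i + k i * (2 * Real.pi)))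
      (g := H) (by fun_prop) (by fun_prop) (fun v => by
        rw [← hH, ← hH, ContinuousMap.comp_apply, ContinuousMap.comp_apply, hE]) v 0
    simpa using this
  let D : (ι → ℤ) →+ ℝ := AddMonoidHom.mk' (fun k : ι → ℤ => H (fun i => k i * (2 * Real.pi)) - H 0) (by
    intro k l
    have h1 := hper l (fun i => k i * (2 * Real.pi))
    have h2 : (fun i => ((k + l) i : ℝ) * (2 * Real.pi)) =
      fun i => (k i : ℝ) * (2 * Real.pi) + l i * (2 * Real.pi) := by
      funext i; simp; ring
    rw [h2]; linarith)
  have hDint : ∀ k, ∃ n : ℤ, D k = n * (2 * Real.pi) := by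
    intro k
    have h1 : Circle.exp (H (fun i => k i * (2 * Real.pi))) = Circle.exp (H 0) := by
      rw [← hH, ← hH]
      have := hE 0 k
      simp only [Pi.zero_apply, zero_add] at this
      rw [ContinuousMap.comp_apply, this]; rfl
    obtain ⟨n, hn⟩ := Circle.exp_eq_exp.1 h1
    exact ⟨n, (sub_eq_of_eq_add' hn :
      H (fun i => k i * (2 * Real.pi)) - H 0 = n * (2 * Real.pi))⟩
  choose N hN using hDint
  let n : ι → ℤ := fun i => N (Pi.single i 1)
  have hD : ∀ k : ι → ℤ, D k = ∑ i, k i * n i * (2 * Real.pi) := by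
    intro k
    conv_lhs => rw [← Finset.univ_sum_single k]
    rw [map_sum]
    refine Finset.sum_congr rfl fun i _ => ?_
    have : Pi.single i (k i) = k i • (Pi.single i 1 : ι → ℤ) := by
      rw [← Pi.single_smul]; simp
    rw [this, map_zsmul, hN]
    simp [n, mul_assoc]
  have hq : Topology.IsQuotientMap E := by
    refine IsOpenMap.isQuotientMap ?_ E.continuous ?_
    · exact IsOpenMap.piMap (fun _ => isLocalHomeomorph_circleExp.isOpenMap)
        (Filter.Eventually.of_forall fun _ => Circle.exp_surjective)
    · intro x
      choose v hv using fun i => Circle.exp_surjective (x i)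
      exact ⟨v, funext hv⟩
  let G : C(ι → ℝ, ℝ) := ⟨fun v => H v - ∑ i, n i * v i, by fun_prop⟩
  have hG : Function.FactorsThrough G E := by
    intro v w hvw
    have : ∀ i, ∃ k : ℤ, v i = w i + k * (2 * Real.pi) := fun i =>
      Circle.exp_eq_exp.1 (congrFun hvw i)
    choose k hk using this
    obtain rfl : v = fun i => w i + k i * (2 * Real.pi) := funext hk
    have h1 := hper k w
    have h2 : H (fun i => k i * (2 * Real.pi)) - H 0 = ∑ i, k i * n i * (2 * Real.pi) := hD k
    simp only [G, ContinuousMap.coe_mk]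
    have h3 : ∑ i, (n i : ℝ) * (w i + k i * (2 * Real.pi)) =
        ∑ i, (n i : ℝ) * w i + ∑ i, (k i : ℝ) * n i * (2 * Real.pi) := by
      rw [← Finset.sum_add_distrib]; exact Finset.sum_congr rfl fun i _ => by ring
    rw [h3]; linarith
  refine ⟨n, hq.lift G hG, fun x => ?_⟩
  obtain ⟨v, rfl⟩ := hq.surjective x
  have h1 : hq.lift G hG (E v) = G v := congrArg (fun f : C(ι → ℝ, ℝ) => f v) (hq.lift_comp G hG)
  rw [h1]
  have h2 := hH v
  rw [ContinuousMap.comp_apply] at h2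
  rw [h2]
  have h3 : ∀ i, E v i ^ n i = Circle.exp (n i * v i) := fun i => (Circle.exp_intCast_mul _ _).symm
  have h4 : ∀ s : Finset ι, ∏ i ∈ s, Circle.exp (n i * v i) = Circle.exp (∑ i ∈ s, n i * v i) := by
    intro s
    induction s using Finset.induction_on with
    | empty => simp
    | insert a s ha ih => rw [Finset.prod_insert ha, Finset.sum_insert ha, Circle.exp_add, ih]
  simp only [h3, h4, ← Circle.exp_add]
  congr 1
  simp [G]

/-- The self-map `f` of the circle has degree `n`. -/
def Circle.HasDegree (f : Circle → Circle) (n : ℤ) : Prop :=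
  ∃ g : C(Circle, ℝ), ∀ t, f t = t ^ n * Circle.exp (g t)

namespace Circle.HasDegree

/-- Pulled back to `ℝ`, the two formulas give lifts of one map, so their variations over a period
agree. The periodic summands drop out, leaving `2πm = 2πn`. -/
theorem unique {f : Circle → Circle} {m n : ℤ} (hm : HasDegree f m) (hn : HasDegree f n) :
    m = n := by
  obtain ⟨g, hg⟩ := hm
  obtain ⟨g', hg'⟩ := hn
  have := Circle.sub_eq_sub_of_exp_eq (f := fun s : ℝ => m * s + g (Circle.exp s))
    (g := fun s : ℝ => n * s + g' (Circle.exp s)) (by fun_prop) (by fun_prop) (fun s => by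
      simp only [Circle.exp_add, Circle.exp_intCast_mul]
      exact (hg _).symm.trans (hg' _)) (2 * Real.pi) 0
  simp only [Circle.exp_two_pi, Circle.exp_zero, mul_zero, zero_add] at this
  have h2 : ((m : ℝ) - n) * (2 * Real.pi) = 0 := by linarith
  have h3 : (m : ℝ) - n = 0 := by
    rcases mul_eq_zero.1 h2 with h | h
    · exact h
    · exact absurd h Real.two_pi_pos.ne'
  exact_mod_cast sub_eq_zero.1 h3

theorem zpow (n : ℤ) : HasDegree (fun t => t ^ n) n := ⟨0, fun t => by simp⟩

theorem const (z : Circle) : HasDegree (fun _ => z) 0 := by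
  obtain ⟨e, he⟩ := Circle.exp_surjective z
  exact ⟨.const _ e, fun t => by simp [he]⟩

theorem exp (g : C(Circle, ℝ)) : HasDegree (fun t => Circle.exp (g t)) 0 :=
  ⟨g, fun t => by simp⟩

theorem mul {f f' : Circle → Circle} {m n : ℤ} (hf : HasDegree f m) (hf' : HasDegree f' n) :
    HasDegree (fun t => f t * f' t) (m + n) := by
  obtain ⟨g, hg⟩ := hf
  obtain ⟨g', hg'⟩ := hf'
  refine ⟨g + g', fun t => ?_⟩
  simp only [hg, hg', ContinuousMap.add_apply, Circle.exp_add, zpow_add]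
  exact mul_mul_mul_comm ..

theorem pow_int {f : Circle → Circle} {m : ℤ} (hf : HasDegree f m) (n : ℤ) :
    HasDegree (fun t => f t ^ n) (n * m) := by
  obtain ⟨g, hg⟩ := hf
  refine ⟨⟨fun t => n * g t, by fun_prop⟩, fun t => ?_⟩
  simp only [hg, mul_zpow, ContinuousMap.coe_mk, Circle.exp_intCast_mul]
  rw [mul_comm n m, zpow_mul]

theorem prod {ι : Type*} (s : Finset ι) {f : ι → Circle → Circle} {m : ι → ℤ}
    (hf : ∀ i, HasDegree (f i) (m i)) : HasDegree (fun t => ∏ i ∈ s, f i t) (∑ i ∈ s, m i) := by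
  classical
  induction s using Finset.induction_on with
  | empty => simpa using const 1
  | insert a s ha ih =>
    simp only [Finset.prod_insert ha, Finset.sum_insert ha]
    exact (hf a).mul ih

theorem of_homotopic {f f' : C(Circle, Circle)} (h : f.Homotopic f') {n : ℤ}
    (hf : HasDegree f n) : HasDegree f' n := by
  obtain ⟨g, hg⟩ := Circle.exists_eq_mul_exp_of_homotopic h
  have := hf.mul (exp g)
  rw [add_zero] at this
  convert this using 2 with t
  exact hg t

theorem _root_.Circle.exists_hasDegree (f : C(Circle, Circle)) : ∃ n, HasDegree f n := by
  obtain ⟨n, g, hg⟩ := Circle.exists_eq_prod_zpow_mul_exp (ι := Unit)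
    (f.comp ⟨fun x => x (), by fun_prop⟩)
  refine ⟨n (), ⟨fun t => g (fun _ => t), by fun_prop⟩, fun t => ?_⟩
  simpa using hg (fun _ => t)

end Circle.HasDegree

/-! ### Degrees of loops in tori and the matrices of torus maps. -/

/-- The coordinates of the loop `l` in a torus have degrees `v`. -/
def TorusLoopHasDegree {ι : Type*} (l : Circle → ι → Circle) (v : ι → ℤ) : Prop :=
  ∀ i, Circle.HasDegree (fun t => l t i) (v i)

theorem TorusLoopHasDegree.unique {ι : Type*} {l : Circle → ι → Circle} {v w : ι → ℤ}
    (hv : TorusLoopHasDegree l v) (hw : TorusLoopHasDegree l w) : v = w :=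
  funext fun i => (hv i).unique (hw i)

/-- A loop in a torus is homotopic to the linear loop with the same degrees. -/
theorem TorusLoopHasDegree.homotopic {ι : Type*} {l : C(Circle, ι → Circle)} {v : ι → ℤ}
    (hv : TorusLoopHasDegree l v) :
    ContinuousMap.Homotopic (⟨fun t i => t ^ v i, by fun_prop⟩ : C(Circle, ι → Circle)) l := by
  choose g hg using hv
  -- The homotopy scales the real exponents from `0` to `g`.
  refine ⟨⟨⟨fun x i => x.2 ^ v i * Circle.exp (x.1 * g i x.2), by fun_prop⟩, fun t => ?_,
    fun t => ?_⟩⟩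
  · funext i; simp
  · funext i; simp [hg]

/-- A map between tori acts on the degrees of loops through an integral matrix. -/
theorem exists_matrix_torusLoopHasDegree {ι κ : Type*} [Fintype ι]
    (Ψ : C(ι → Circle, κ → Circle)) : ∃ M : Matrix κ ι ℤ, ∀ l v, TorusLoopHasDegree l v →
      Continuous l → TorusLoopHasDegree (fun t => Ψ (l t)) (M.mulVec v) := by
  -- Row `k` of the matrix is the character in the `k`-th coordinate of `Ψ`; the exponential factor
  -- has degree `0` along every loop.
  choose n g hg using fun k : κ => Circle.exists_eq_prod_zpow_mul_exp
    (⟨fun x => Ψ x k, by fun_prop⟩ : C(ι → Circle, Circle))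
  refine ⟨Matrix.of n, fun l v hl hc k => ?_⟩
  have h := (Circle.HasDegree.prod Finset.univ (fun i => (hl i).pow_int (n k i))).mul
    (Circle.HasDegree.exp ⟨fun t => g k (l t), by fun_prop⟩)
  rw [add_zero] at h
  have h2 : (fun t => Ψ (l t) k) = fun t => (∏ i, l t i ^ n k i) * Circle.exp (g k (l t)) :=
    funext fun t => hg k (l t)
  rw [h2]
  exact h

/-- If a torus homeomorphism acts on loops by `M`, its inverse acts by an inverse matrix. -/
theorem exists_matrix_torusHomeomorph {ι : Type*} [Fintype ι] [DecidableEq ι]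
    (Ψ : (ι → Circle) ≃ₜ (ι → Circle)) : ∃ M N : Matrix ι ι ℤ, M * N = 1 ∧
      (∀ l v, TorusLoopHasDegree l v → Continuous l →
        TorusLoopHasDegree (fun t => Ψ (l t)) (M.mulVec v)) ∧
      (∀ l v, TorusLoopHasDegree l v → Continuous l →
        TorusLoopHasDegree (fun t => Ψ.symm (l t)) (N.mulVec v)) := by
  obtain ⟨M, hM⟩ := exists_matrix_torusLoopHasDegree (Ψ : C(ι → Circle, ι → Circle))
  obtain ⟨N, hN⟩ := exists_matrix_torusLoopHasDegree (Ψ.symm : C(ι → Circle, ι → Circle))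
  refine ⟨M, N, ?_, hM, hN⟩
  apply Matrix.mulVec_injective
  funext v
  -- Every integral vector is realized by a linear loop, so `M * N = 1` follows from uniqueness of
  -- degrees for `Ψ ∘ Ψ⁻¹`.
  let l : Circle → ι → Circle := fun t i => t ^ v i
  have hl : Continuous l := by fun_prop
  have hv : TorusLoopHasDegree l v := fun i => Circle.HasDegree.zpow (v i)
  have h := hM _ _ (hN _ _ hv hl) (by fun_prop)
  simp only [ContinuousMap.coe_coe, Homeomorph.apply_symm_apply] at h
  rw [Matrix.one_mulVec, ← Matrix.mulVec_mulVec]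
  exact h.unique hv

/-- If an invertible matrix carries `e₃` to `(r, s, p)` with `r`, `s` coprime, then the first two
entries of the inverse image of `e₃` are coprime. -/
theorem isCoprime_of_mulVec_single {M N : Matrix (Fin 3) (Fin 3) ℤ} (h : M * N = 1) {r s p : ℤ}
    (hrs : IsCoprime r s) (hM : M.mulVec ![0, 0, 1] = ![r, s, p]) :
    IsCoprime (N.mulVec ![0, 0, 1] 0) (N.mulVec ![0, 0, 1] 1) := by
  obtain ⟨x, y, hxy⟩ := hrs
  have hN : N * M = 1 := mul_eq_one_comm.1 h
  have h1 : N.mulVec ![r, s, p] = ![0, 0, 1] := by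
    rw [← hM, Matrix.mulVec_mulVec, hN, Matrix.one_mulVec]
  -- The Bézout relation `x * r + y * s = 1` completes `(r, s, p)` and `e₃` to a unimodular matrix.
  -- `N` carries its columns to `e₃, b, a` with `a = N e₃`, so the unit `N.det` equals `b 0 * a 1 -
  -- b 1 * a 0`.
  have hdet : (N * !![r, -y, 0; s, x, 0; p, 0, 1]).det = N.det := by
    have : (!![r, -y, 0; s, x, 0; p, 0, 1] : Matrix (Fin 3) (Fin 3) ℤ).det = 1 := by
      rw [Matrix.det_fin_three]
      simp
      linarith
    rw [Matrix.det_mul, this, mul_one]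
  have hunit : IsUnit N.det := Matrix.isUnit_det_of_left_inverse h
  have hcols : N * !![r, -y, 0; s, x, 0; p, 0, 1] =
      (Matrix.of ![N.mulVec ![r, s, p], N.mulVec ![-y, x, 0], N.mulVec ![0, 0, 1]]).transpose := by
    ext i j
    fin_cases j <;> simp [Matrix.mul_apply, Matrix.mulVec, dotProduct, Fin.sum_univ_three]
  rw [hcols, h1, Matrix.det_transpose, Matrix.det_fin_three] at hdet
  simp only [Matrix.of_apply, Matrix.cons_val_zero, Matrix.cons_val_one, Matrix.cons_val] at hdet
  generalize N.mulVec ![0, 0, 1] = a at *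
  generalize N.mulVec ![-y, x, 0] = b at *
  obtain ⟨w, hw⟩ := hunit.exists_right_inv
  refine ⟨-b 1 * w, b 0 * w, ?_⟩
  rw [← hw, ← hdet]; ring

/-! ### Winding numbers on singular homology -/

/-- The variation between two points of a real lift of a circle-valued map. -/
noncomputable def Circle.variation {K : Type*} [TopologicalSpace K] [ContractibleSpace K]
    (f : C(K, Circle)) (a b : K) : ℝ :=
  (Circle.exists_exp_lift f).choose b - (Circle.exists_exp_lift f).choose a

/-- The chosen lift is immaterial: two lifts differ by a constant, which cancels in the difference.
-/
theorem Circle.variation_eq {K : Type*} [TopologicalSpace K] [ContractibleSpace K]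
    {f : C(K, Circle)} {g : K → ℝ} (hg : Continuous g) (h : ∀ x, f x = Circle.exp (g x))
    (a b : K) : Circle.variation f a b = g b - g a := by
  have := Circle.sub_eq_sub_of_exp_eq (Circle.exists_exp_lift f).choose.continuous hg
    (fun x => by rw [← h, (Circle.exists_exp_lift f).choose_spec]) a b
  unfold Circle.variation
  linarith

instance stdSimplex.contractibleSpace (n : ℕ) : ContractibleSpace (stdSimplex ℝ (Fin (n + 1))) :=
  (convex_stdSimplex ℝ _).contractibleSpace ⟨_, single_mem_stdSimplex ℝ 0⟩

section

open CategoryTheory AlgebraicTopology Simplicial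

/-- The singular simplex of a space given by a continuous map. -/
noncomputable def singularSimplex {Y : Type u} [TopologicalSpace Y] (n : ℕ)
    (σ : C(stdSimplex ℝ (Fin (n + 1)), Y)) : (TopCat.toSSet.obj (TopCat.of Y)) _⦋n⦌ :=
  ((TopCat.of Y).toSSetObjEquiv (.op ⦋n⦌)).symm σ

theorem singularSimplex_surjective {Y : Type u} [TopologicalSpace Y] {n : ℕ}
    (x : (TopCat.toSSet.obj (TopCat.of Y)) _⦋n⦌) : ∃ σ, singularSimplex n σ = x :=
  ((TopCat.of Y).toSSetObjEquiv (.op ⦋n⦌)).symm.surjective x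

theorem singularSimplex_map {Y Z : Type u} [TopologicalSpace Y] [TopologicalSpace Z] {n : ℕ}
    (f : C(Y, Z)) (σ : C(stdSimplex ℝ (Fin (n + 1)), Y)) :
    (TopCat.toSSet.map (TopCat.ofHom f)).app (.op ⦋n⦌) (singularSimplex n σ) =
      singularSimplex n (f.comp σ) := rfl

theorem singularSimplex_δ {Y : Type u} [TopologicalSpace Y] {n : ℕ} (i : Fin (n + 2))
    (σ : C(stdSimplex ℝ (Fin (n + 2)), Y)) :
    (TopCat.toSSet.obj (TopCat.of Y)).δ i (singularSimplex (n + 1) σ) =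
      singularSimplex n (σ.comp ⟨stdSimplex.map (Fin.succAbove i),
        stdSimplex.continuous_map _⟩) := rfl


open stdSimplex in
/-- The coboundary of the winding cochain vanishes. -/
theorem Circle.variation_face_add {τ : C(stdSimplex ℝ (Fin 3), Circle)} :
    Circle.variation (τ.comp ⟨stdSimplex.map (Fin.succAbove (0 : Fin 3)),
        stdSimplex.continuous_map _⟩) (vertex (0 : Fin 2)) (vertex 1) -
      Circle.variation (τ.comp ⟨stdSimplex.map (Fin.succAbove (1 : Fin 3)),
        stdSimplex.continuous_map _⟩) (vertex (0 : Fin 2)) (vertex 1) +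
      Circle.variation (τ.comp ⟨stdSimplex.map (Fin.succAbove (2 : Fin 3)),
        stdSimplex.continuous_map _⟩) (vertex (0 : Fin 2)) (vertex 1) = 0 := by
  -- A single lift on the triangle restricts to lifts on all three faces, so the alternating sum
  -- telescopes over the vertices.
  obtain ⟨g, hg⟩ := Circle.exists_exp_lift τ
  have key : ∀ i : Fin 3, Circle.variation (τ.comp ⟨stdSimplex.map (Fin.succAbove i),
      stdSimplex.continuous_map _⟩) (vertex (0 : Fin 2)) (vertex 1) =
      g (vertex (i.succAbove 1)) - g (vertex (i.succAbove 0)) := by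
    intro i
    rw [Circle.variation_eq (g := fun x => g (stdSimplex.map (Fin.succAbove i) x))
      (g.continuous.comp (stdSimplex.continuous_map _)) (fun x => hg _)]
    rw [map_vertex, map_vertex]
  rw [key, key, key]
  have h1 : (0 : Fin 3).succAbove (1 : Fin 2) = 2 := rfl
  have h2 : (0 : Fin 3).succAbove (0 : Fin 2) = 1 := rfl
  have h3 : (1 : Fin 3).succAbove (1 : Fin 2) = 2 := rfl
  have h4 : (1 : Fin 3).succAbove (0 : Fin 2) = 0 := rfl
  have h5 : (2 : Fin 3).succAbove (1 : Fin 2) = 1 := rfl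
  have h6 : (2 : Fin 3).succAbove (0 : Fin 2) = 0 := rfl
  rw [h1, h2, h3, h4, h5, h6]
  ring

/-- The homomorphism `ℤ → ℝ` with value `r` at `1`. -/
noncomputable def realHom : ℝ →+
    (AddCommGrpCat.of (ULift.{u} ℤ) ⟶ AddCommGrpCat.of (ULift.{u} ℝ)) where
  toFun r := AddCommGrpCat.ofHom
    { toFun := fun n => ⟨n.down * r⟩
      map_zero' := by ext; simp
      map_add' := fun m n => by ext; simp [add_mul] }
  map_zero' := by ext n; simp
  map_add' r s := by ext n; simp [mul_add]

theorem realHom_injective : Function.Injective realHom.{u} := by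
  intro r s h
  have := congrArg (fun f => (f.hom ⟨1⟩).down) h
  simpa [realHom] using this

/-- The coefficient group of `singularH1`. -/
noncomputable abbrev integerCoeff : AddCommGrpCat.{u} := AddCommGrpCat.of (ULift.{u} ℤ)

/-- The singular chain complex with integer coefficients. -/
noncomputable abbrev singularChains (Y : Type u) [TopologicalSpace Y] :
    ChainComplex AddCommGrpCat.{u} ℕ :=
  (TopCat.toSSet.obj (TopCat.of Y)).chainComplex integerCoeff

/-- The cochain that assigns to a singular 1-simplex the variation along it of the circle-valued
map `h`. -/
noncomputable def windingCochain {Y : Type u} [TopologicalSpace Y] (h : C(Y, Circle)) :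
    (singularChains Y).X 1 ⟶ AddCommGrpCat.of (ULift.{u} ℝ) :=
  Limits.Sigma.desc fun x => realHom (Circle.variation
    (h.comp ((TopCat.of Y).toSSetObjEquiv (.op ⦋1⦌) x)) (stdSimplex.vertex (0 : Fin 2))
      (stdSimplex.vertex 1))

theorem ι_windingCochain {Y : Type u} [TopologicalSpace Y] (h : C(Y, Circle))
    (σ : C(stdSimplex ℝ (Fin 2), Y)) :
    SSet.ιChainComplex _ (singularSimplex 1 σ) ≫ windingCochain h =
      realHom (Circle.variation (h.comp σ) (stdSimplex.vertex (0 : Fin 2))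
        (stdSimplex.vertex 1)) :=
  Limits.Sigma.ι_desc _ _

/-- Chains are a coproduct over simplices, so the cocycle condition reduces to
`Circle.variation_face_add` on each 2-simplex. -/
theorem d_windingCochain {Y : Type u} [TopologicalSpace Y] (h : C(Y, Circle)) :
    (singularChains Y).d 2 1 ≫ windingCochain h = 0 := by
  refine SSet.chainComplex_hom_ext fun x => ?_
  obtain ⟨τ, rfl⟩ := singularSimplex_surjective x
  rw [SSet.ιChainComplex_d_assoc, Preadditive.sum_comp, Limits.comp_zero]
  simp only [singularSimplex_δ, Preadditive.zsmul_comp, ι_windingCochain]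
  refine (Fin.sum_univ_three _).trans ?_
  simp only [← map_zsmul, ← map_add]
  rw [← map_zero realHom]
  congr 1
  refine Eq.trans ?_ (Circle.variation_face_add (τ := h.comp τ))
  simp [sub_eq_add_neg, ContinuousMap.comp_assoc]

/-- The winding number of 1-cycles with respect to a circle-valued map. -/
noncomputable def windingHom {Y : Type u} [TopologicalSpace Y] (h : C(Y, Circle)) :
    singularH1 Y ⟶ AddCommGrpCat.of (ULift.{u} ℝ) :=
  -- A cocycle factors through chains modulo boundaries, into which homology embeds.
  (singularChains Y).homologyι 1 ≫
    (singularChains Y).descOpcycles (windingCochain h) 2 (by simp) (d_windingCochain h)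

/-! ### The fundamental class of the circle and its winding numbers. -/

/-- The singular 1-simplex that runs once around the circle. -/
noncomputable def circleSimplex : C(stdSimplex ℝ (Fin 2), ULift.{u} Circle) :=
  ⟨fun x => ⟨Circle.exp (2 * Real.pi * x.1 1)⟩, by
    have : Continuous fun x : stdSimplex ℝ (Fin 2) => x.1 1 :=
      (continuous_apply 1).comp continuous_subtype_val
    exact continuous_uliftUp.comp (Circle.exp.continuous.comp (continuous_const.mul this))⟩

/-- Both endpoints are the point `1`, so the two faces are the same constant simplex and cancel. -/
theorem circleSimplex_d : SSet.ιChainComplex (R := integerCoeff.{u}) _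
    (singularSimplex 1 circleSimplex.{u}) ≫ (singularChains (ULift.{u} Circle)).d 1 0 = 0 := by
  have : ∀ i : Fin 2, ∀ x, circleSimplex (stdSimplex.map (Fin.succAbove i)
      (x : stdSimplex ℝ (Fin 1))) = ⟨1⟩ := by
    intro i x
    obtain rfl : x = stdSimplex.vertex 0 := Subsingleton.elim _ _
    rw [stdSimplex.map_vertex]
    fin_cases i <;> simp [circleSimplex]
  have h2 : ∀ i : Fin 2, circleSimplex.comp ⟨stdSimplex.map (Fin.succAbove i),
      stdSimplex.continuous_map _⟩ = .const (stdSimplex ℝ (Fin 1)) ⟨1⟩ := fun i =>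
    ContinuousMap.ext (this i)
  rw [SSet.ιChainComplex_d]
  simp only [singularSimplex_δ]
  refine (Fin.sum_univ_two _).trans ?_
  rw [h2, h2]
  simp

/-- The fundamental class of the circle. -/
noncomputable def circleClass : integerCoeff.{u} ⟶ singularH1 (ULift.{u} Circle) :=
  (singularChains (ULift.{u} Circle)).liftCycles _ 0 (by simp) circleSimplex_d ≫
    (singularChains (ULift.{u} Circle)).homologyπ 1

/-- Pairing a cocycle with the image of a cycle can be done on chains, which reduces winding numbers
to a computation on one simplex. -/
theorem HomologicalComplex.liftCycles_homologyMap_descOpcycles {C ι : Type*} [Category* C]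
    [Limits.HasZeroMorphisms C] {c : ComplexShape ι} {K L : HomologicalComplex C c} (φ : K ⟶ L)
    {i j j' : ι} [K.HasHomology i] [L.HasHomology i] {A B : C} (a : A ⟶ K.X i) (b : L.X i ⟶ B)
    (hj : c.next i = j) (ha : a ≫ K.d i j = 0) (hj' : c.prev i = j') (hb : L.d j' i ≫ b = 0) :
    (K.liftCycles a j hj ha ≫ K.homologyπ i) ≫ homologyMap φ i ≫ L.homologyι i ≫
      L.descOpcycles b j' hj' hb = a ≫ φ.f i ≫ b := by
  rw [Category.assoc, homologyπ_naturality_assoc, homology_π_ι_assoc, p_descOpcycles,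
    cyclesMap_i_assoc, liftCycles_i_assoc]

/-- Along the simplex that runs once round the circle, the lift is a linear function of total
variation `2πn` plus a term with equal values at both ends. -/
theorem circleClass_loopClass_windingHom {Y : Type u} [TopologicalSpace Y] (c : C(Circle, Y))
    (h : C(Y, Circle)) {n : ℤ} (hn : Circle.HasDegree (h.comp c) n) :
    circleClass ≫ loopClass c ≫ windingHom h = realHom (n * (2 * Real.pi)) := by
  have h1 : circleClass ≫ loopClass c ≫ windingHom h =
      SSet.ιChainComplex (R := integerCoeff.{u}) _ (singularSimplex 1 circleSimplex.{u}) ≫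
        (SSet.chainComplexMap (TopCat.toSSet.map (TopCat.ofHom
          (c.comp ⟨ULift.down, continuous_uliftDown⟩))) integerCoeff).f 1 ≫
          windingCochain h :=
    HomologicalComplex.liftCycles_homologyMap_descOpcycles _ _ _ _ _ _ _
  rw [h1, SSet.ι_chainComplexMap_f_assoc, singularSimplex_map, ι_windingCochain]
  obtain ⟨g, hg⟩ := hn
  rw [Circle.variation_eq (g := fun x : stdSimplex ℝ (Fin 2) =>
    n * (2 * Real.pi * x.1 1) + g (Circle.exp (2 * Real.pi * x.1 1)))]
  · simp
  · have : Continuous fun x : stdSimplex ℝ (Fin 2) => 2 * Real.pi * x.1 1 :=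
      continuous_const.mul ((continuous_apply 1).comp continuous_subtype_val)
    exact (continuous_const.mul this).add (g.continuous.comp (Circle.exp.continuous.comp this))
  · intro x
    rw [Circle.exp_add, Circle.exp_intCast_mul]
    exact hg _

/-- A linear relation between the homology classes of loops holds for their degrees. -/
theorem Circle.HasDegree.eq_of_loopClass {Y : Type u} [TopologicalSpace Y] {c c₁ c₂ : C(Circle, Y)}
    {m n : ℤ} (hc : loopClass c = m • loopClass c₁ + n • loopClass c₂) (h : C(Y, Circle))
    {d d₁ d₂ : ℤ} (hd : Circle.HasDegree (h.comp c) d) (hd₁ : Circle.HasDegree (h.comp c₁) d₁)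
    (hd₂ : Circle.HasDegree (h.comp c₂) d₂) : d = m * d₁ + n * d₂ := by
  have h1 := circleClass_loopClass_windingHom c h hd
  rw [hc] at h1
  simp only [Preadditive.add_comp, Preadditive.comp_add, Preadditive.zsmul_comp,
    Preadditive.comp_zsmul, circleClass_loopClass_windingHom _ h hd₁,
    circleClass_loopClass_windingHom _ h hd₂, ← map_zsmul, ← map_add] at h1
  have h2 := realHom_injective h1
  have h3 : ((m * d₁ + n * d₂ - d : ℤ) : ℝ) * (2 * Real.pi) = 0 := by
    push_cast
    simp only [zsmul_eq_mul] at h2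
    linarith
  rcases mul_eq_zero.1 h3 with h | h
  · have : m * d₁ + n * d₂ - d = 0 := by exact_mod_cast h
    linarith
  · exact absurd h Real.two_pi_pos.ne'

/-- Freely homotopic loops are homologous. -/
theorem loopClass_eq_of_homotopic {Y : Type u} [TopologicalSpace Y] {c c' : C(Circle, Y)}
    (h : c.Homotopic c') : loopClass c = loopClass c' := by
  obtain ⟨H⟩ := h.comp (ContinuousMap.Homotopic.refl
    (⟨ULift.down, continuous_uliftDown⟩ : C(ULift.{u} Circle, Circle)))
  exact TopCat.Homotopy.congr_homologyMap_singularChainComplexFunctor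
    (f := TopCat.ofHom (c.comp ⟨ULift.down, continuous_uliftDown⟩))
    (g := TopCat.ofHom (c'.comp ⟨ULift.down, continuous_uliftDown⟩)) H integerCoeff 1

end

/-! ### Diffeomorphisms onto images -/

namespace IsDiffeoOnImage

variable {E H M E' H' M' E'' H'' M'' : Type*}
  [NormedAddCommGroup E] [NormedSpace ℝ E] [TopologicalSpace H] {I : ModelWithCorners ℝ E H}
  [TopologicalSpace M] [ChartedSpace H M]
  [NormedAddCommGroup E'] [NormedSpace ℝ E'] [TopologicalSpace H'] {I' : ModelWithCorners ℝ E' H'}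
  [TopologicalSpace M'] [ChartedSpace H' M']
  [NormedAddCommGroup E''] [NormedSpace ℝ E''] [TopologicalSpace H'']
  {I'' : ModelWithCorners ℝ E'' H''} [TopologicalSpace M''] [ChartedSpace H'' M'']
  {f : M → M'} {s : Set M}

theorem injOn (h : IsDiffeoOnImage I I' f s) : Set.InjOn f s := by
  obtain ⟨-, g, -, hg⟩ := h
  exact hg.injOn

theorem mono (h : IsDiffeoOnImage I I' f s) {t : Set M} (hts : t ⊆ s) :
    IsDiffeoOnImage I I' f t := by
  obtain ⟨hf, g, hg, hgf⟩ := h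
  exact ⟨hf.mono hts, g, hg.mono (Set.image_mono hts), hgf.mono hts⟩

theorem comp {f' : M' → M''} {s' : Set M'} (h' : IsDiffeoOnImage I' I'' f' s')
    (h : IsDiffeoOnImage I I' f s) (hs : Set.MapsTo f s s') : IsDiffeoOnImage I I'' (f' ∘ f) s := by
  obtain ⟨hf, g, hg, hgf⟩ := h
  obtain ⟨hf', g', hg', hgf'⟩ := h'.mono hs.image_subset
  refine ⟨hf'.comp hf (Set.mapsTo_image f s), g ∘ g', ?_, fun x hx => ?_⟩
  · rw [Set.image_comp]
    refine hg.comp hg' ?_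
    rintro _ ⟨y, hy, rfl⟩
    rwa [Set.mem_preimage, hgf' hy]
  · simp only [Function.comp_apply]
    rw [hgf' (Set.mem_image_of_mem f hx), hgf hx]

/-- The inverse is a diffeomorphism as well. -/
theorem exists_inverse (h : IsDiffeoOnImage I I' f s) :
    ∃ g : M' → M, IsDiffeoOnImage I' I g (f '' s) ∧ Set.LeftInvOn g f s ∧ g '' (f '' s) = s := by
  obtain ⟨hf, g, hg, hgf⟩ := h
  have him : g '' (f '' s) = s := hgf.image_image
  refine ⟨g, ⟨hg, f, ?_, ?_⟩, hgf, him⟩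
  · rwa [him]
  · rintro _ ⟨x, hx, rfl⟩
    rw [hgf hx]

/-- The homeomorphism onto the image underlying a diffeomorphism onto the image. -/
theorem exists_homeomorph (h : IsDiffeoOnImage I I' f s) :
    ∃ e : s ≃ₜ f '' s, ∀ x, (e x : M') = f x := by
  obtain ⟨hf, g, hg, hgf⟩ := h
  refine ⟨⟨⟨fun x => ⟨f x, x, x.2, rfl⟩, fun y => ⟨g y, ?_⟩, fun x => ?_, ?_⟩, ?_, ?_⟩, fun x => rfl⟩
  · obtain ⟨_, x, hx, rfl⟩ := y
    rwa [hgf hx]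
  · exact Subtype.ext (hgf x.2)
  · rintro ⟨_, x, hx, rfl⟩
    exact Subtype.ext (congrArg f (hgf hx))
  · exact (continuousOn_iff_continuous_domRestrict.1 hf.continuousOn).subtype_mk _
  · exact (continuousOn_iff_continuous_domRestrict.1 hg.continuousOn).subtype_mk _

end IsDiffeoOnImage

/-! ### Framed tori and exteriors -/

theorem isCompact_discBundle : IsCompact discBundle := by
  have : discBundle = Set.univ ×ˢ (Set.univ ×ˢ Metric.closedBall (0 : ℂ) 1) := by
    ext x; simp [discBundle]
  rw [this]
  exact isCompact_univ.prod (isCompact_univ.prod (isCompact_closedBall _ _))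

theorem circleBundle_subset : circleBundle ⊆ discBundle := fun _ hx => le_of_eq hx

theorem openDiscBundle_subset : openDiscBundle ⊆ discBundle := fun x (hx : ‖x.2.2‖ < 1) =>
  (hx.le : ‖x.2.2‖ ≤ 1)

theorem disjoint_circleBundle_openDiscBundle : Disjoint circleBundle openDiscBundle :=
  Set.disjoint_left.2 fun _ hx hx' => absurd hx (ne_of_lt hx')

theorem discBundle_eq_union : discBundle = circleBundle ∪ openDiscBundle := by
  ext x; exact le_iff_eq_or_lt (a := ‖x.2.2‖)

namespace Framing

variable {X : Type*} [TopologicalSpace X] [ChartedSpace (EuclideanSpace ℝ (Fin 4)) X]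
  {oX : SmoothOrientation X} {T : Set X} (Φ : Framing oX T)

theorem isClosed_nbhd [T2Space X] : IsClosed Φ.nbhd :=
  (isCompact_discBundle.image_of_continuousOn Φ.diffeo.1.continuousOn).isClosed

theorem nbhd_eq_union : Φ.nbhd = Φ.boundary ∪ Φ.toFun '' openDiscBundle := by
  rw [nbhd, discBundle_eq_union, Set.image_union]; rfl

theorem disjoint_boundary : Disjoint Φ.boundary (Φ.toFun '' openDiscBundle) := by
  rw [Set.disjoint_left]
  rintro _ ⟨x, hx, rfl⟩ ⟨y, hy, hxy⟩
  rw [Φ.diffeo.injOn (openDiscBundle_subset hy) (circleBundle_subset hx) hxy] at hy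
  exact Set.disjoint_left.1 disjoint_circleBundle_openDiscBundle hx hy

theorem boundary_subset_exterior : Φ.boundary ⊆ Φ.exterior :=
  Set.subset_compl_iff_disjoint_right.2 Φ.disjoint_boundary

theorem compl_nbhd_subset_exterior : Φ.nbhdᶜ ⊆ Φ.exterior :=
  Set.compl_subset_compl.2 (Set.image_mono openDiscBundle_subset)

theorem exterior_eq_union : Φ.exterior = Φ.boundary ∪ Φ.nbhdᶜ := by
  have h1 := Φ.nbhd_eq_union
  have h2 := Φ.boundary_subset_exterior
  have h3 := Φ.compl_nbhd_subset_exterior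
  ext x
  constructor
  · intro hx
    by_cases hn : x ∈ Φ.nbhd
    · rw [h1] at hn
      exact hn.elim Or.inl fun h => absurd h hx
    · exact Or.inr hn
  · rintro (h | h)
    exacts [h2 h, h3 h]

theorem exterior_union_nbhd : Φ.exterior ∪ Φ.nbhd = Set.univ := by
  rw [exterior_eq_union, Set.union_assoc, Set.compl_union_self, Set.union_univ]

theorem boundary_subset_nbhd : Φ.boundary ⊆ Φ.nbhd := Set.image_mono circleBundle_subset

theorem exterior_inter_nbhd : Φ.exterior ∩ Φ.nbhd = Φ.boundary := by
  rw [exterior_eq_union, Set.union_inter_distrib_right, Set.compl_inter_self, Set.union_empty]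
  exact Set.inter_eq_left.2 Φ.boundary_subset_nbhd

end Framing

/-! ### Orientations -/

/-- `fderiv` defaults to `0` at points of non-differentiability, and `0` has determinant `0` in
dimension four. Positivity of a Jacobian therefore includes differentiability. -/
theorem differentiableAt_of_det_fderiv_pos {f : EuclideanSpace ℝ (Fin 4) → EuclideanSpace ℝ (Fin 4)}
    {v : EuclideanSpace ℝ (Fin 4)} (h : 0 < (fderiv ℝ f v).det) : DifferentiableAt ℝ f v := by
  by_contra hd
  rw [fderiv_zero_of_not_differentiableAt hd] at h
  have : (0 : EuclideanSpace ℝ (Fin 4) →L[ℝ] EuclideanSpace ℝ (Fin 4)).det = 0 := by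
    change LinearMap.det (0 : EuclideanSpace ℝ (Fin 4) →ₗ[ℝ] EuclideanSpace ℝ (Fin 4)) = 0
    rw [LinearMap.det_zero]
    simp
  exact absurd h (this ▸ lt_irrefl _)

theorem ContinuousLinearMap.det_comp_eq_mul {R M : Type*} [CommRing R] [TopologicalSpace M]
    [AddCommGroup M] [Module R M] (f g : M →L[R] M) : (f.comp g).det = f.det * g.det :=
  LinearMap.det_comp f.toLinearMap g.toLinearMap

/-- A smooth local inverse of an orientation preserving map preserves orientation. -/
theorem PreservesOrientationOn.of_inverse {X Y : Type*}
    [TopologicalSpace X] [ChartedSpace (EuclideanSpace ℝ (Fin 4)) X] [IsManifold (𝓡 4) ∞ X]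
    [TopologicalSpace Y] [ChartedSpace (EuclideanSpace ℝ (Fin 4)) Y] [IsManifold (𝓡 4) ∞ Y]
    {oX : SmoothOrientation X} {oY : SmoothOrientation Y} {f : X → Y} {g : Y → X}
    {s : Set X} {t : Set Y} (hf : PreservesOrientationOn oX oY f s) (ht : IsOpen t)
    (hg : ContMDiffOn (𝓡 4) (𝓡 4) ∞ g t) (hgt : Set.MapsTo g t s) (hfg : Set.LeftInvOn f g t) :
    PreservesOrientationOn oY oX g t := by
  intro y hy e he e' he' hye hgye'
  have hP := hf (g y) (hgt hy) e' he' e he hgye' (by rwa [hfg hy])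
  have hPd := differentiableAt_of_det_fderiv_pos hP
  have hgc : ContinuousAt g y := (hg.contMDiffAt (ht.mem_nhds hy)).continuousAt
  have hQ : DifferentiableAt ℝ (e' ∘ g ∘ e.symm) (e y) := by
    have h1 : ContMDiffAt (𝓡 4) (𝓡 4) ∞ e.symm (e y) :=
      (contMDiffOn_symm_of_mem_maximalAtlas (oY.smooth he)).contMDiffAt
        (e.open_target.mem_nhds (e.map_source hye))
    have h2 : ContMDiffAt (𝓡 4) (𝓡 4) ∞ g (e.symm (e y)) := by
      rw [e.left_inv hye]; exact hg.contMDiffAt (ht.mem_nhds hy)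
    have h3 : ContMDiffAt (𝓡 4) (𝓡 4) ∞ e' (g (e.symm (e y))) := by
      rw [e.left_inv hye]
      exact (contMDiffOn_of_mem_maximalAtlas (oX.smooth he')).contMDiffAt
        (e'.open_source.mem_nhds hgye')
    have h4 : ContMDiffAt (𝓡 4) (𝓡 4) ∞ (e' ∘ g ∘ e.symm) (e y) :=
      h3.comp (e y) (h2.comp (e y) h1)
    exact (contMDiffAt_iff_contDiffAt.1 h4).differentiableAt (by simp)
  have hval : (e' ∘ g ∘ e.symm) (e y) = e' (g y) := by simp [e.left_inv hye]
  -- In charts the two maps compose to the identity near `e y`. By the chain rule the Jacobians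
  -- multiply to `1`, and one of them is positive.
  have hcomp : (e ∘ f ∘ e'.symm) ∘ (e' ∘ g ∘ e.symm) =ᶠ[nhds (e y)] id := by
    have hc : Filter.Tendsto e.symm (nhds (e y)) (nhds y) := by
      have := e.continuousAt_symm (e.map_source hye)
      rwa [ContinuousAt, e.left_inv hye] at this
    filter_upwards [e.open_target.mem_nhds (e.map_source hye),
      hc (ht.mem_nhds hy), hc (hgc (e'.open_source.mem_nhds hgye'))] with v h1 h2 h3
    simp only [Function.comp_apply, id]
    rw [e'.left_inv h3, hfg h2, e.right_inv h1]
  have hfd := hcomp.fderiv_eq (𝕜 := ℝ)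
  rw [fderiv_comp _ (by rwa [hval]) hQ, hval, fderiv_id] at hfd
  have hdet := congrArg ContinuousLinearMap.det hfd
  have hmul : (fderiv ℝ (e ∘ f ∘ e'.symm) (e' (g y))).det *
      (fderiv ℝ (e' ∘ g ∘ e.symm) (e y)).det = 1 := by
    rw [← ContinuousLinearMap.det_comp_eq_mul, hdet]
    exact LinearMap.det_id (A := ℝ) (M := EuclideanSpace ℝ (Fin 4))
  exact pos_of_mul_pos_right (hmul ▸ one_pos) hP.le

/-! ### The inverse of a torus surgery -/

namespace TorusSurgery

variable {X Y : Type*}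
  [TopologicalSpace X] [ChartedSpace (EuclideanSpace ℝ (Fin 4)) X]
  [TopologicalSpace Y] [ChartedSpace (EuclideanSpace ℝ (Fin 4)) Y]
  {oX : SmoothOrientation X} {T : Set X} {Φ : Framing oX T}
  {γ : C(Circle, Circle × Circle)} {p q : ℤ} {oY : SmoothOrientation Y}
  (S : TorusSurgery Φ γ p q oY)

theorem incl_image_boundary : S.incl '' Φ.boundary = S.tube.boundary := by
  rw [← S.gluing_image, Set.image_image]
  exact Set.image_congr S.incl_gluing

/-- A point of the open tube in the image would lie in the overlap, hence on the tube's boundary,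
which is impossible. A point outside the tube must be covered by the other piece. -/
theorem incl_image_exterior : S.incl '' Φ.exterior = S.tube.exterior := by
  have h1 := S.cover
  have h2 := S.inter
  have h3 := S.tube.exterior_eq_union
  have h4 := S.tube.disjoint_boundary
  have h5 := S.tube.nbhd_eq_union
  ext y
  constructor
  · intro hy hy'
    have : y ∈ S.incl '' Φ.exterior ∩ S.tube.nbhd := ⟨hy, Set.image_mono openDiscBundle_subset hy'⟩
    rw [h2] at this
    exact Set.disjoint_left.1 h4 this hy'
  · intro hy
    rw [h3] at hy
    rcases hy with hy | hy
    · exact (h2.symm ▸ hy : y ∈ S.incl '' Φ.exterior ∩ S.tube.nbhd).1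
    · exact (h1.symm ▸ Set.mem_univ y :
        y ∈ S.incl '' Φ.exterior ∪ S.tube.nbhd).resolve_right hy

theorem incl_image_compl_nbhd : S.incl '' Φ.nbhdᶜ = S.tube.nbhdᶜ := by
  have h1 : Φ.nbhdᶜ = Φ.exterior \ Φ.boundary := by
    rw [← Φ.exterior_inter_nbhd, Set.sdiff_self_inter]
    exact (Set.inter_eq_right.2 Φ.compl_nbhd_subset_exterior).symm
  have h2 : S.tube.nbhdᶜ = S.tube.exterior \ S.tube.boundary := by
    rw [← S.tube.exterior_inter_nbhd, Set.sdiff_self_inter]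
    exact (Set.inter_eq_right.2 S.tube.compl_nbhd_subset_exterior).symm
  rw [h1, h2, S.incl_diffeo.injOn.image_sdiff_subset Φ.boundary_subset_exterior,
    S.incl_image_exterior, S.incl_image_boundary]

/-- If the push-off of `α` is homologous to the meridian, then `X` is the result of the
`0`-surgery along `α` on the core torus. -/
theorem exists_inverse [IsManifold (𝓡 4) ∞ X] [T2Space Y] [IsManifold (𝓡 4) ∞ Y]
    {α : C(Circle, Circle × Circle)} (hα : IsPrimitiveCurve α)
    (hom : HomologousIn S.tube.boundary (S.tube.pushOff α) (S.incl ∘ Φ.meridian)) :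
    ∃ R : TorusSurgery S.tube α 0 1 oX,
      R.core = T ∧ Set.EqOn R.tube.toFun Φ.toFun discBundle ∧
        Set.LeftInvOn R.incl S.incl Φ.exterior := by
  obtain ⟨g, hgd, hgf, him⟩ := S.incl_diffeo.exists_inverse
  rw [S.incl_image_exterior] at hgd him
  have hmaps : Set.MapsTo Φ.toFun circleBundle Φ.exterior := fun x hx =>
    Φ.boundary_subset_exterior (Set.mem_image_of_mem _ hx)
  refine ⟨{ coprime := isCoprime_one_right
            primitive := hα
            incl := g
            incl_diffeo := hgd
            incl_oriented := ?_
            core := T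
            tube := Φ
            -- The gluing map is the inclusion of `∂ν(T)` parametrized by `Φ`, so `{pt} × ∂D²`
            -- becomes the image of `μ_T`.
            gluing := S.incl ∘ Φ.toFun
            gluing_diffeo := S.incl_diffeo.comp (Φ.diffeo.mono circleBundle_subset) hmaps
            gluing_image := by
              rw [Set.image_comp]; exact S.incl_image_boundary
            incl_gluing := fun x hx => hgf (hmaps hx)
            cover := by rw [him]; exact Φ.exterior_union_nbhd
            inter := by rw [him]; exact Φ.exterior_inter_nbhd
            gluing_homology := ?_ }, rfl, fun _ _ => rfl, hgf⟩
  · refine S.incl_oriented.of_inverse S.tube.isClosed_nbhd.isOpen_compl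
      (hgd.1.mono S.tube.compl_nbhd_subset_exterior) ?_ ?_
    all_goals
      rw [← S.incl_image_compl_nbhd]
      rintro _ ⟨x, hx, rfl⟩
      rw [hgf (Φ.compl_nbhd_subset_exterior hx)]
    exact hx
  -- With coefficients `1` and `0` the relation is the hypothesis on `α`; the meridian of the tube
  -- only has to be exhibited as a loop in the boundary.
  · obtain ⟨c, c', hc, hc', h⟩ := hom
    obtain ⟨e, he⟩ := (S.tube.diffeo.mono circleBundle_subset).exists_homeomorph
    refine ⟨c', c, ⟨fun t => e ⟨(1, 1, (t : ℂ)), Circle.norm_coe t⟩, by fun_prop⟩, hc', hc,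
      fun t => he _, ?_⟩
    rw [h, one_smul, zero_smul, add_zero]

end TorusSurgery

/-! ### Change of framing -/

/-- The automorphism `(x, y, z) ↦ (x, y, x ^ i * y ^ j * z)` of `T² × ℂ`. -/
noncomputable def torusTwist (i j : ℤ) (x : TorusPlane) : TorusPlane :=
  (x.1, x.2.1, ((x.1 ^ i * x.2.1 ^ j : Circle) : ℂ) * x.2.2)

theorem norm_torusTwist (i j : ℤ) (x : TorusPlane) : ‖(torusTwist i j x).2.2‖ = ‖x.2.2‖ := by
  simp only [torusTwist, norm_mul, Circle.norm_coe, one_mul]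

theorem torusTwist_neg (i j : ℤ) (x : TorusPlane) :
    torusTwist (-i) (-j) (torusTwist i j x) = x := by
  obtain ⟨a, b, z⟩ := x
  refine Prod.ext rfl (Prod.ext rfl ?_)
  simp only [torusTwist]
  rw [← mul_assoc, ← Circle.coe_mul]
  have : (a ^ (-i) * b ^ (-j) * (a ^ i * b ^ j) : Circle) = 1 := by
    rw [mul_mul_mul_comm, ← zpow_add, ← zpow_add]; simp
  rw [this]; simp

theorem torusTwist_neg' (i j : ℤ) (x : TorusPlane) :
    torusTwist i j (torusTwist (-i) (-j) x) = x := by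
  simpa using torusTwist_neg (-i) (-j) x

theorem torusTwist_of_mem_zeroSection (i j : ℤ) {x : TorusPlane} (hx : x ∈ zeroSection) :
    torusTwist i j x = x := by
  obtain ⟨a, b, z⟩ := x
  obtain rfl : z = 0 := hx
  simp [torusTwist]

theorem image_torusTwist (i j : ℤ) {s : Set TorusPlane}
    (hs : ∀ x y : TorusPlane, ‖x.2.2‖ = ‖y.2.2‖ → x ∈ s → y ∈ s) : torusTwist i j '' s = s := by
  refine Set.Subset.antisymm ?_ fun x hx => ⟨torusTwist (-i) (-j) x, ?_, torusTwist_neg' i j x⟩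
  · rintro _ ⟨x, hx, rfl⟩
    exact hs x _ (norm_torusTwist i j x).symm hx
  · exact hs x _ (norm_torusTwist _ _ x).symm hx

theorem image_torusTwist_discBundle (i j : ℤ) : torusTwist i j '' discBundle = discBundle :=
  image_torusTwist i j fun _ _ h hx => h.symm.trans_le hx

theorem image_torusTwist_circleBundle (i j : ℤ) : torusTwist i j '' circleBundle = circleBundle :=
  image_torusTwist i j fun _ _ h hx => h.symm.trans hx

attribute [local instance] finrank_real_complex_fact' in
theorem contMDiff_circle_coe : ContMDiff (M := Circle) (𝓡 1) 𝓘(ℝ, ℂ) ∞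
    (fun x : Circle => (x : ℂ)) :=
  (contMDiff_coe_sphere :
    ContMDiff (𝓡 1) 𝓘(ℝ, ℂ) ∞ ((↑) : Metric.sphere (0 : ℂ) 1 → ℂ))

theorem contMDiff_circle_zpow (n : ℤ) : ContMDiff (𝓡 1) (𝓡 1) ∞ (fun x : Circle => x ^ n) := by
  have : LieGroup (𝓡 1) ∞ Circle := LieGroup.of_le (n := ω) le_top
  cases n with
  | ofNat n => simpa using contMDiff_pow n
  | negSucc n => simpa [zpow_negSucc] using (contMDiff_pow (n + 1)).inv

theorem contMDiff_torusTwist (i j : ℤ) :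
    ContMDiff torusPlaneModel torusPlaneModel ∞ (torusTwist i j) := by
  have : LieGroup (𝓡 1) ∞ Circle := LieGroup.of_le (n := ω) le_top
  have h1 : ContMDiff torusPlaneModel (𝓡 1) ∞ (fun x : TorusPlane => x.1) := contMDiff_fst
  have h23 : ContMDiff torusPlaneModel ((𝓡 1).prod 𝓘(ℝ, ℂ)) ∞ (fun x : TorusPlane => x.2) :=
    contMDiff_snd
  have h2 : ContMDiff torusPlaneModel (𝓡 1) ∞ (fun x : TorusPlane => x.2.1) :=
    contMDiff_fst.comp h23
  have h3 : ContMDiff torusPlaneModel 𝓘(ℝ, ℂ) ∞ (fun x : TorusPlane => x.2.2) :=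
    contMDiff_snd.comp h23
  have h4 : ContMDiff torusPlaneModel (𝓡 1) ∞ (fun x : TorusPlane => x.1 ^ i * x.2.1 ^ j) :=
    ((contMDiff_circle_zpow i).comp h1).mul ((contMDiff_circle_zpow j).comp h2)
  have h5 : ContMDiff torusPlaneModel 𝓘(ℝ, ℂ) ∞
      (fun x : TorusPlane => ((x.1 ^ i * x.2.1 ^ j : Circle) : ℂ)) := contMDiff_circle_coe.comp h4
  have hm : ContMDiff (𝓘(ℝ, ℂ).prod 𝓘(ℝ, ℂ)) 𝓘(ℝ, ℂ) ∞ (fun z : ℂ × ℂ => z.1 * z.2) := by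
    rw [contMDiff_iff]
    exact ⟨continuous_mul, fun _ _ => contDiff_mul.contDiffOn⟩
  exact h1.prodMk (h2.prodMk (hm.comp (h5.prodMk h3)))

theorem isDiffeoOnImage_torusTwist (i j : ℤ) (s : Set TorusPlane) :
    IsDiffeoOnImage torusPlaneModel torusPlaneModel (torusTwist i j) s :=
  ⟨(contMDiff_torusTwist i j).contMDiffOn, torusTwist (-i) (-j),
    (contMDiff_torusTwist _ _).contMDiffOn, fun x _ => torusTwist_neg i j x⟩

/-- The lift of `torusTwist` to `ℝ⁴`. -/
noncomputable def torusTwistLift (i j : ℤ) (v : EuclideanSpace ℝ (Fin 4)) :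
    EuclideanSpace ℝ (Fin 4) :=
  !₂[v 0, v 1, Real.cos (i * v 0 + j * v 1) * v 2 - Real.sin (i * v 0 + j * v 1) * v 3,
    Real.sin (i * v 0 + j * v 1) * v 2 + Real.cos (i * v 0 + j * v 1) * v 3]

/-- Multiplication by a unit complex number rotates its real coordinates. Orientations of framings
are tested in this cover, so it suffices to differentiate the lift. -/
theorem torusPlaneCover_torusTwistLift (i j : ℤ) (v : EuclideanSpace ℝ (Fin 4)) :
    torusPlaneCover (torusTwistLift i j v) = torusTwist i j (torusPlaneCover v) := by
  refine Prod.ext (by simp [torusPlaneCover, torusTwistLift, torusTwist])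
    (Prod.ext (by simp [torusPlaneCover, torusTwistLift, torusTwist]) ?_)
  simp only [torusPlaneCover, torusTwistLift, torusTwist]
  rw [← Circle.exp_intCast_mul, ← Circle.exp_intCast_mul, ← Circle.exp_add, Circle.coe_exp,
    Complex.exp_mul_I, ← Complex.ofReal_cos, ← Complex.ofReal_sin]
  apply Complex.ext <;> simp <;> ring

/-- The derivative of `torusTwistLift`. -/
noncomputable def torusTwistMatrix (i j : ℤ) (v : EuclideanSpace ℝ (Fin 4)) :
    Matrix (Fin 4) (Fin 4) ℝ :=
  let θ : ℝ := i * v 0 + j * v 1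
  let a := -Real.sin θ * v 2 - Real.cos θ * v 3
  let b := Real.cos θ * v 2 - Real.sin θ * v 3
  !![1, 0, 0, 0; 0, 1, 0, 0; a * i, a * j, Real.cos θ, -Real.sin θ;
    b * i, b * j, Real.sin θ, Real.cos θ]

/-- The matrix is block triangular, with an identity block and a rotation block on the diagonal. -/
theorem det_torusTwistMatrix (i j : ℤ) (v : EuclideanSpace ℝ (Fin 4)) :
    (torusTwistMatrix i j v).det = 1 := by
  rw [Matrix.det_succ_row_zero]
  simp [torusTwistMatrix, Fin.sum_univ_succ, Matrix.det_fin_three, Fin.succAbove]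
  rw [← sq, ← sq, Real.cos_sq_add_sin_sq]

theorem hasFDerivAt_torusTwistLift (i j : ℤ) (v : EuclideanSpace ℝ (Fin 4)) :
    HasFDerivAt (torusTwistLift i j) (LinearMap.toContinuousLinearMap
      (Matrix.toLin (EuclideanSpace.basisFun (Fin 4) ℝ).toBasis
        (EuclideanSpace.basisFun (Fin 4) ℝ).toBasis (torusTwistMatrix i j v))) v := by
  have hp : ∀ k, HasFDerivAt (fun x : EuclideanSpace ℝ (Fin 4) => x k)
      (EuclideanSpace.proj k : EuclideanSpace ℝ (Fin 4) →L[ℝ] ℝ) v := fun k =>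
    (EuclideanSpace.proj k : EuclideanSpace ℝ (Fin 4) →L[ℝ] ℝ).hasFDerivAt
  have hθ := ((hp 0).const_mul (i : ℝ)).add ((hp 1).const_mul (j : ℝ))
  rw [← hasFDerivWithinAt_univ, hasFDerivWithinAt_euclidean]
  simp only [hasFDerivWithinAt_univ]
  intro k
  fin_cases k
  · convert! hp 0 using 1
    ext w; simp [torusTwistMatrix, Matrix.toLin_apply, Matrix.mulVec, dotProduct, Fin.sum_univ_four]
  · convert! hp 1 using 1
    ext w; simp [torusTwistMatrix, Matrix.toLin_apply, Matrix.mulVec, dotProduct, Fin.sum_univ_four]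
  · convert! (hθ.cos.mul (hp 2)).sub (hθ.sin.mul (hp 3)) using 1
    ext w; simp [torusTwistMatrix, Matrix.toLin_apply, Matrix.mulVec, dotProduct, Fin.sum_univ_four]
    ring
  · convert! (hθ.sin.mul (hp 2)).add (hθ.cos.mul (hp 3)) using 1
    ext w; simp [torusTwistMatrix, Matrix.toLin_apply, Matrix.mulVec, dotProduct, Fin.sum_univ_four]
    ring

theorem det_fderiv_torusTwistLift (i j : ℤ) (v : EuclideanSpace ℝ (Fin 4)) :
    (fderiv ℝ (torusTwistLift i j) v).det = 1 := by
  rw [(hasFDerivAt_torusTwistLift i j v).fderiv]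
  refine Eq.trans ?_ (det_torusTwistMatrix i j v)
  exact LinearMap.det_toLin _ _

namespace Framing

variable {X : Type*} [TopologicalSpace X] [ChartedSpace (EuclideanSpace ℝ (Fin 4)) X]
  {oX : SmoothOrientation X} {T : Set X} (Φ : Framing oX T)

/-- The framing twisted by `torusTwist`. -/
noncomputable def twist (i j : ℤ) : Framing oX T where
  toFun := Φ.toFun ∘ torusTwist i j
  diffeo := Φ.diffeo.comp (isDiffeoOnImage_torusTwist i j _)
    (Set.mapsTo_iff_image_subset.2 (image_torusTwist_discBundle i j).subset)
  oriented v hv e he hve := by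
    have hcover : (e ∘ (Φ.toFun ∘ torusTwist i j) ∘ torusPlaneCover) =
        (e ∘ Φ.toFun ∘ torusPlaneCover) ∘ torusTwistLift i j := by
      funext w; simp [torusPlaneCover_torusTwistLift]
    have hmem : torusPlaneCover (torusTwistLift i j v) ∈ openDiscBundle := by
      rw [torusPlaneCover_torusTwistLift]
      exact (norm_torusTwist i j _).trans_lt hv
    have hpos := Φ.oriented _ hmem e he (by rwa [torusPlaneCover_torusTwistLift])
    rw [hcover, fderiv_comp _ (differentiableAt_of_det_fderiv_pos hpos)
      (hasFDerivAt_torusTwistLift i j v).differentiableAt]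
    rw [ContinuousLinearMap.det_comp_eq_mul, det_fderiv_torusTwistLift, mul_one]
    exact hpos
  image_zeroSection := by
    refine Eq.trans ?_ Φ.image_zeroSection
    exact Set.image_congr fun x hx => congrArg Φ.toFun (torusTwist_of_mem_zeroSection i j hx)

theorem twist_nbhd (i j : ℤ) : (Φ.twist i j).nbhd = Φ.nbhd := by
  rw [nbhd, nbhd, twist, Set.image_comp, image_torusTwist_discBundle]

theorem twist_boundary (i j : ℤ) : (Φ.twist i j).boundary = Φ.boundary := by
  rw [boundary, boundary, twist, Set.image_comp, image_torusTwist_circleBundle]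

end Framing

namespace TorusSurgery

variable {X Y : Type*}
  [TopologicalSpace X] [ChartedSpace (EuclideanSpace ℝ (Fin 4)) X]
  [TopologicalSpace Y] [ChartedSpace (EuclideanSpace ℝ (Fin 4)) Y]
  {oX : SmoothOrientation X} {T : Set X} {Φ : Framing oX T}
  {γ : C(Circle, Circle × Circle)} {p q : ℤ} {oY : SmoothOrientation Y}
  (S : TorusSurgery Φ γ p q oY)

/-- The same surgery, with the gluing map twisted by `torusTwist`. -/
noncomputable def twist (i j : ℤ) : TorusSurgery Φ γ p q oY where
  coprime := S.coprime
  primitive := S.primitive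
  incl := S.incl
  incl_diffeo := S.incl_diffeo
  incl_oriented := S.incl_oriented
  core := S.core
  tube := S.tube.twist i j
  gluing := S.gluing ∘ torusTwist i j
  gluing_diffeo := S.gluing_diffeo.comp (isDiffeoOnImage_torusTwist i j _)
    (Set.mapsTo_iff_image_subset.2 (image_torusTwist_circleBundle i j).subset)
  gluing_image := by rw [Set.image_comp, image_torusTwist_circleBundle, S.gluing_image]
  incl_gluing x hx := S.incl_gluing _ ((norm_torusTwist i j x).trans hx)
  cover := by rw [Framing.twist_nbhd, S.cover]
  inter := by rw [Framing.twist_nbhd, Framing.twist_boundary, S.inter]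
  -- The twist fixes the fibre over `(1, 1)` pointwise, so the surgery coefficient is unchanged.
  gluing_homology := by
    simpa [torusTwist] using S.gluing_homology

end TorusSurgery

/-- A Bézout relation recovers `t` from `t ^ m` and `t ^ n`, which makes the loop simple. -/
theorem isPrimitiveCurve_linearLoop {m n : ℤ} (h : IsCoprime m n) :
    IsPrimitiveCurve (linearLoop m n) := by
  refine ⟨fun t t' htt' => ?_, m, n, h, .refl _⟩
  obtain ⟨a, b, hab⟩ := h
  have h1 : t ^ m = t' ^ m := congrArg Prod.fst htt'
  have h2 : t ^ n = t' ^ n := congrArg Prod.snd htt'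
  have key : ∀ s : Circle, s = (s ^ m) ^ a * (s ^ n) ^ b := fun s => by
    rw [← zpow_mul, ← zpow_mul, ← zpow_add, mul_comm m, mul_comm n, hab, zpow_one]
  rw [key t, key t', h1, h2]

/-! ### The degrees of the meridian in the glued-in piece -/

/-- The standard identification of the 3-torus with `T² × ∂D²`. -/
noncomputable def torusHomeomorphCircleBundle : (Fin 3 → Circle) ≃ₜ circleBundle where
  toFun x := ⟨(x 0, x 1, (x 2 : ℂ)), Circle.norm_coe _⟩
  invFun x := ![x.1.1, x.1.2.1, ⟨x.1.2.2, mem_sphere_zero_iff_norm.2 x.2⟩]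
  left_inv x := by
    funext k; fin_cases k <;> rfl
  right_inv x := rfl
  continuous_toFun := by fun_prop
  continuous_invFun := by
    refine continuous_pi fun k => ?_
    fin_cases k
    · exact continuous_fst.comp continuous_subtype_val
    · exact (continuous_fst.comp continuous_snd).comp continuous_subtype_val
    · exact Continuous.subtype_mk ((continuous_snd.comp continuous_snd).comp
        continuous_subtype_val) _

theorem IsPrimitiveCurve.exists_hasDegree {γ : C(Circle, Circle × Circle)}
    (h : IsPrimitiveCurve γ) : ∃ r s : ℤ, IsCoprime r s ∧
      Circle.HasDegree (fun t => (γ t).1) r ∧ Circle.HasDegree (fun t => (γ t).2) s := by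
  obtain ⟨-, r, s, hrs, hγ⟩ := h
  refine ⟨r, s, hrs, ?_, ?_⟩
  · exact Circle.HasDegree.of_homotopic (f := ⟨fun t => t ^ r, by fun_prop⟩)
      (f' := (ContinuousMap.fst).comp γ)
      ((ContinuousMap.Homotopic.refl ContinuousMap.fst).comp hγ.symm) (.zpow r)
  · exact Circle.HasDegree.of_homotopic (f := ⟨fun t => t ^ s, by fun_prop⟩)
      (f' := (ContinuousMap.snd).comp γ)
      ((ContinuousMap.Homotopic.refl ContinuousMap.snd).comp hγ.symm) (.zpow s)

namespace TorusSurgery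

variable {X Y : Type*}
  [TopologicalSpace X] [ChartedSpace (EuclideanSpace ℝ (Fin 4)) X]
  [TopologicalSpace Y] [ChartedSpace (EuclideanSpace ℝ (Fin 4)) Y]
  {oX : SmoothOrientation X} {T : Set X} {Φ : Framing oX T}
  {γ : C(Circle, Circle × Circle)} {p : ℤ} {oY : SmoothOrientation Y}

/-- In an integral surgery the meridian is homotopic in the boundary of the glued-in piece to a
linear loop with coprime components along the core. -/
theorem exists_meridian_homotopic (S : TorusSurgery Φ γ p 1 oY) :
    ∃ (v : Fin 3 → ℤ) (c c' : C(Circle, S.tube.boundary)), IsCoprime (v 0) (v 1) ∧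
      (∀ t, (c t : Y) = S.tube.toFun (t ^ v 0, t ^ v 1, ((t ^ v 2 : Circle) : ℂ))) ∧
      (∀ t, (c' t : Y) = S.incl (Φ.meridian t)) ∧ c.Homotopic c' := by
  obtain ⟨e₁, he₁⟩ := (Φ.diffeo.mono circleBundle_subset).exists_homeomorph
  obtain ⟨e₂', he₂'⟩ := S.gluing_diffeo.exists_homeomorph
  obtain ⟨e₂, he₂⟩ : ∃ e₂ : circleBundle ≃ₜ Φ.boundary, ∀ x, (e₂ x : X) = S.gluing x :=
    ⟨e₂'.trans (.setCongr S.gluing_image), he₂'⟩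
  obtain ⟨e₃, he₃⟩ := (S.tube.diffeo.mono circleBundle_subset).exists_homeomorph
  let κ := torusHomeomorphCircleBundle
  let F₁ : (Fin 3 → Circle) ≃ₜ Φ.boundary := κ.trans e₁
  let Ψ : (Fin 3 → Circle) ≃ₜ (Fin 3 → Circle) := (κ.trans e₂).trans F₁.symm
  obtain ⟨M, N, hMN, hM, hN⟩ := exists_matrix_torusHomeomorph Ψ
  -- This loop has two roles: `Ψ ∘ l` is the glued-in fibre in the coordinates of `Φ`, and `Ψ.symm ∘
  -- l` is `μ_T` in the glued-in coordinates.
  let l : C(Circle, Fin 3 → Circle) := ⟨fun t => ![1, 1, t], by fun_prop⟩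
  have hl : TorusLoopHasDegree l ![0, 0, 1] := by
    intro k
    fin_cases k
    · exact Circle.HasDegree.const 1
    · exact Circle.HasDegree.const 1
    · simpa [l] using Circle.HasDegree.zpow 1
  have hNl := hN l _ hl l.continuous
  have hMl := hM l _ hl l.continuous
  obtain ⟨r, s, hrs, hr, hs⟩ := S.primitive.exists_hasDegree
  obtain ⟨c, c₁, c₂, hc, hc₁, hc₂, hrel⟩ := S.gluing_homology
  have hcF : ∀ t, F₁.symm (c t) = Ψ (l t) := fun t => by
    have : c t = e₂ (κ (l t)) := Subtype.ext (by rw [hc, he₂]; rfl)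
    rw [this]; rfl
  have hc₁F : ∀ t, F₁.symm (c₁ t) = ![(γ t).1, (γ t).2, 1] := fun t => by
    rw [Homeomorph.symm_apply_eq]
    refine Subtype.ext ((hc₁ t).trans ?_)
    exact (he₁ _).symm ▸ rfl
  have hc₂F : ∀ t, F₁.symm (c₂ t) = l t := fun t => by
    rw [Homeomorph.symm_apply_eq]
    refine Subtype.ext ((hc₂ t).trans ?_)
    exact (he₁ _).symm ▸ rfl
  -- The homology relation is tested against the three circle-valued coordinates of `∂ν(T)`.
  have hMv : M.mulVec ![0, 0, 1] = ![r, s, p] := by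
    have hγdeg : ∀ k, Circle.HasDegree (fun t => (![(γ t).1, (γ t).2, 1] : Fin 3 → Circle) k)
        ((![r, s, 0] : Fin 3 → ℤ) k) := by
      intro k
      fin_cases k
      exacts [hr, hs, Circle.HasDegree.const 1]
    have hk : ∀ k, M.mulVec ![0, 0, 1] k =
        1 * (![r, s, 0] : Fin 3 → ℤ) k + p * (![0, 0, 1] : Fin 3 → ℤ) k := by
      intro k
      let h : C(Φ.boundary, Circle) := ⟨fun x => F₁.symm x k, by fun_prop⟩
      refine Circle.HasDegree.eq_of_loopClass hrel h ?_ ?_ ?_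
      · convert hMl k using 2 with t
        exact congrFun (hcF t) k
      · convert hγdeg k using 2 with t
        exact congrFun (hc₁F t) k
      · convert hl k using 2 with t
        exact congrFun (hc₂F t) k
    funext k
    rw [hk]
    fin_cases k <;> simp
  let l' : C(Circle, Fin 3 → Circle) := (Ψ.symm : C(_, _)).comp l
  have hhom := TorusLoopHasDegree.homotopic (l := l') hNl
  let F₃ : C(Fin 3 → Circle, S.tube.boundary) := (κ.trans e₃ : _ ≃ₜ S.tube.boundary)
  refine ⟨N.mulVec ![0, 0, 1], F₃.comp _, F₃.comp l', isCoprime_of_mulVec_single hMN hrs hMv,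
    fun t => he₃ _, fun t => ?_, (ContinuousMap.Homotopic.refl F₃).comp hhom⟩
  have h1 : (F₃ (l' t) : Y) = S.tube.toFun (κ (l' t)) := he₃ _
  have h2 : e₂ (κ (l' t)) = F₁ (l t) := by
    have : Ψ (Ψ.symm (l t)) = l t := Ψ.apply_symm_apply _
    exact (F₁.symm_apply_eq.1 this)
  have h3 : S.gluing (κ (l' t)) = Φ.meridian t := by
    rw [← he₂, h2]
    exact he₁ _
  rw [ContinuousMap.comp_apply, h1, ← S.incl_gluing _ (κ (l' t)).2, h3]

/-- After a twist of the gluing map, the meridian is homotopic to the push-off of a primitive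
curve on the core of an integral surgery. -/
theorem exists_twist_freelyHomotopicIn (S : TorusSurgery Φ γ p 1 oY) :
    ∃ (i j : ℤ) (α : C(Circle, Circle × Circle)), IsPrimitiveCurve α ∧
      FreelyHomotopicIn (S.twist i j).tube.boundary ((S.twist i j).tube.pushOff α)
        ((S.twist i j).incl ∘ Φ.meridian) := by
  obtain ⟨v, c, c', hv, hc, hc', h⟩ := S.exists_meridian_homotopic
  obtain ⟨a, b, hab⟩ := id hv
  -- Since `a * v 0 + b * v 1 = 1`, these exponents turn the constant last coordinate of the
  -- push-off into `t ^ v 2`.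
  refine ⟨v 2 * a, v 2 * b, linearLoop (v 0) (v 1), isPrimitiveCurve_linearLoop hv, ?_⟩
  change FreelyHomotopicIn (S.tube.twist _ _).boundary _ _
  rw [Framing.twist_boundary]
  refine ⟨c, c', fun t => (hc t).trans ?_, hc', h⟩
  change _ = S.tube.toFun (torusTwist (v 2 * a) (v 2 * b) (t ^ v 0, t ^ v 1, 1))
  have : (t ^ v 0) ^ (v 2 * a) * (t ^ v 1) ^ (v 2 * b) = t ^ v 2 := by
    rw [← zpow_mul, ← zpow_mul, ← zpow_add]
    congr 1
    linear_combination v 2 * hab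
  simp only [torusTwist, this, mul_one]

end TorusSurgery

/-! ### From free homotopy to homology, and the conclusion. -/

theorem FreelyHomotopicIn.homologousIn {X : Type*} [TopologicalSpace X] {S : Set X}
    {l l' : Circle → X} (h : FreelyHomotopicIn S l l') : HomologousIn S l l' := by
  obtain ⟨c, c', hc, hc', h⟩ := h
  exact ⟨c, c', hc, hc', loopClass_eq_of_homotopic h⟩

theorem mainTheorem9 {X X' : Type*}
    [TopologicalSpace X] [T2Space X] [SecondCountableTopology X]
    [ChartedSpace (EuclideanSpace ℝ (Fin 4)) X] [IsManifold (𝓡 4) ∞ X]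
    [TopologicalSpace X'] [T2Space X'] [SecondCountableTopology X']
    [ChartedSpace (EuclideanSpace ℝ (Fin 4)) X'] [IsManifold (𝓡 4) ∞ X']
    (oX : SmoothOrientation X) (oX' : SmoothOrientation X')
    (T : Set X) (Φ : Framing oX T) (γ : C(Circle, Circle × Circle)) (p : ℤ)
    (S : TorusSurgery Φ γ p 1 oX') :
    -- every primitive curve on the core whose push-off is homologous to the meridian works
    (∀ α : C(Circle, Circle × Circle), IsPrimitiveCurve α →
      HomologousIn S.tube.boundary (S.tube.pushOff α) (S.incl ∘ Φ.meridian) →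
        ∃ R : TorusSurgery S.tube α 0 1 oX,
          R.core = T ∧ Set.EqOn R.tube.toFun Φ.toFun discBundle ∧
          Set.LeftInvOn R.incl S.incl Φ.exterior) ∧
    -- the gluing map can be chosen (same manifold, exterior and core) so that there is such a curve
    ∃ S' : TorusSurgery Φ γ p 1 oX',
      Set.EqOn S'.incl S.incl Φ.exterior ∧ S'.core = S.core ∧ S'.tube.nbhd = S.tube.nbhd ∧
      Set.EqOn S'.tube.toFun S.tube.toFun zeroSection ∧
      ∃ α : C(Circle, Circle × Circle), IsPrimitiveCurve α ∧
        FreelyHomotopicIn S'.tube.boundary (S'.tube.pushOff α) (S'.incl ∘ Φ.meridian) ∧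
        ∃ R : TorusSurgery S'.tube α 0 1 oX,
          R.core = T ∧ Set.EqOn R.tube.toFun Φ.toFun discBundle ∧
          Set.LeftInvOn R.incl S'.incl Φ.exterior := by
  refine ⟨fun α hα hom => S.exists_inverse hα hom, ?_⟩
  obtain ⟨i, j, α, hα, h⟩ := S.exists_twist_freelyHomotopicIn
  -- The twist only reparametrizes the tube, fixing its zero section; the first part then applies to
  -- the twisted surgery.
  exact ⟨S.twist i j, fun _ _ => rfl, rfl, S.tube.twist_nbhd i j,
    fun x hx => congrArg S.tube.toFun (torusTwist_of_mem_zeroSection i j hx), α, hα, h,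
    (S.twist i j).exists_inverse hα h.homologousIn⟩
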